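/- Let $K$ be a field of characteristic zero, $n\ge 0$, and let $P_{2n}=K[x_1,\dots,x_{2n}]$ be the polynomial algebra with the classical Poisson bracket $$\{f,g\}=\sum_{i=1}^n\left(\frac{\partial f}{\partial x_i}\frac{\partial g}{\partial x_{n+i}}-\frac{\partial f}{\partial x_{n+i}}\frac{\partial g}{\partial x_i}\right).$$ For a Poisson $K$-algebra $P$ and $a\in P$ write $\operatorname{ad}(a)=\{a,\cdot\}$, and let $A(P)$ be the associative $K$-algebra of operators on $P$ (a subalgebra of the ring of differential operators $\mathcal D(P)\subseteq \operatorname{End}_K(P)$) generated by the multiplications by elements of $P$ and by all $\operatorname{ad}(a)$, $a\in P$. The Poisson algebra $P$ is called strongly simple if (1) $P$ is a finitely generated associative algebra and a domain; (2) $A(P)$ is a simple algebra with centre $K$; (3) whenever $a_1,\dots,a_m\in P$ are algebraically independent over $K$ and $\{a_i,a_j\}=0$ for all $i,j$, the commuting elements $a_1,\dots,a_m,\operatorname{ad}(a_1),\dots,\operatorname{ad}(a_m)$ of $A(P)$ are algebraically independent over $K$. The Weyl algebra $A_m$ is the $K$-algebra with generators $x_1,\dots,x_m,\partial_1,\dots,\partial_m$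 and defining relations $x_ix_j=x_jx_i$, $\partial_i\partial_j=\partial_j\partial_i$, $\partial_ix_j-x_j\partial_i=\delta_{ij}$. For $f:\mathbb N\to\mathbb N$ put $\gamma(f)=\inf\{r\in\mathbb R \mid f(i)\le i^r \text{ for all } i\gg 0\}$. The Gelfand-Kirillov dimension of a $K$-algebra $C$ is $$\operatorname{GK}(C)=\sup_S\,\gamma\bigl(i\mapsto\dim_K (K+KS)^i\bigr),$$ where $S$ runs over the finite subsets of $C$ and $KS$ is the linear span of $S$ (if $C$ is finitely generated, it is enough to take for $S$ any one finite generating set). 1. $P_{2n}$ is a strongly simple Poisson algebra, and $A(P_{2n})$ is canonically isomorphic to the Weyl algebra $A_{2n}$: there is a $K$-algebra isomorphism $A_{2n}\to A(P_{2n})$ that sends $x_j$ to the multiplication by $x_j$ and $\partial_j$ to $\partial/\partial x_j$, for $j=1,\dots,2n$. 2. Every isotropic subalgebra $C$ of $P_{2n}$, i.e. every $K$-subalgebra with $\{C,C\}=0$, satisfies $\operatorname{GK}(C)\le n$. -/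

import Mathlib

/-- A Poisson algebra structure on a commutative associative `K`-algebra `P`: a `K`-bilinear
Lie bracket that satisfies the Leibniz rule. (Mathlib's `Bracket` notation on a ring is the
commutator, so the Poisson bracket is kept as explicit data.) -/
structure PoissonStructure (K P : Type*) [Field K] [CommRing P] [Algebra K P] where
  /-- The map `a ↦ {a, ·}`. -/
  bracket : P →ₗ[K] P →ₗ[K] P
  bracket_self : ∀ a, bracket a a = 0
  jacobi : ∀ a b c, bracket a (bracket b c) + bracket b (bracket c a)
    + bracket c (bracket a b) = 0
  leibniz : ∀ a x y, bracket a (x * y) = bracket a x * y + x * bracket a y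

/-- A family `b` of elements of a (not necessarily commutative) `K`-algebra `A` consists of
commuting, algebraically independent elements: there is an injective algebra homomorphism from the
polynomial algebra `K[X i]` to `A` with `X i ↦ b i`. (Such a homomorphism, if it exists, is unique,
and it exists exactly when the `b i` commute pairwise.) -/
def CommAlgIndep (K : Type*) {ι A : Type*} [Field K] [Ring A] [Algebra K A] (b : ι → A) : Prop :=
  ∃ φ : MvPolynomial ι K →ₐ[K] A, (∀ i, φ (MvPolynomial.X i) = b i) ∧ Function.Injective φ

namespace PoissonStructure

variable {K P : Type*} [Field K] [CommRing P] [Algebra K P] (B : PoissonStructure K P)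

/-- The inner derivation `ad a = {a, ·}`, as a `K`-linear operator on `P`. -/
def ad (a : P) : Module.End K P := B.bracket a

/-- The algebra `A(P)`: the associative `K`-algebra of operators on `P` generated by the
multiplications by elements of `P` and by the inner derivations `ad a`, `a ∈ P`. (The ring of
differential operators on `P` is a subalgebra of `End_K(P)` that contains all these generators, so
the subalgebra they generate is the same in either algebra.) -/
def opAlgebra : Subalgebra K (Module.End K P) :=
  Algebra.adjoin K (Set.range (LinearMap.mulLeft K : P → Module.End K P) ∪ Set.range B.ad)

/-- Multiplication by `a ∈ P`, as an element of `A(P)`. -/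
def opMul (a : P) : B.opAlgebra :=
  ⟨LinearMap.mulLeft K a, Algebra.subset_adjoin (Or.inl ⟨a, rfl⟩)⟩

/-- The inner derivation `ad a`, as an element of `A(P)`. -/
def opAd (a : P) : B.opAlgebra :=
  ⟨B.ad a, Algebra.subset_adjoin (Or.inr ⟨a, rfl⟩)⟩

/-- Strongly simple Poisson algebras. -/
structure IsStronglySimple : Prop where
  finiteType : Algebra.FiniteType K P
  isDomain : IsDomain P
  isCentral : Algebra.IsCentral K B.opAlgebra
  isSimple : IsSimpleRing B.opAlgebra
  /-- If `a_1, …, a_m ∈ P` are algebraically independent and Poisson commute, then the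
  (commuting) elements `a_1, …, a_m, ad a_1, …, ad a_m` of `A(P)` are algebraically independent. -/
  algIndep : ∀ (m : ℕ) (a : Fin m → P), AlgebraicIndependent K a →
    (∀ i j, B.bracket (a i) (a j) = 0) →
    CommAlgIndep K (Sum.elim (fun i => B.opMul (a i)) (fun i => B.opAd (a i)))

/-- A subalgebra `C` of `P` is isotropic if `{C, C} = 0`. -/
def IsIsotropic (C : Subalgebra K P) : Prop :=
  ∀ a ∈ C, ∀ b ∈ C, B.bracket a b = 0

end PoissonStructure

section ClassicalBracket

open MvPolynomial

variable (K : Type*) [Field K] (n : ℕ)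

/-- The classical Poisson bracket on `K[x_1, …, x_{2n}]` as a bilinear map,
`{f, g} = ∑ i, (∂f/∂x_i ∂g/∂x_{n+i} - ∂f/∂x_{n+i} ∂g/∂x_i)`. For `i : Fin n`, the index of
the variable `x_i` is `Fin.castAdd n i` and that of `x_{n+i}` is `Fin.natAdd n i`. -/
noncomputable def classicalBracket :
    MvPolynomial (Fin (n + n)) K →ₗ[K] MvPolynomial (Fin (n + n)) K →ₗ[K]
      MvPolynomial (Fin (n + n)) K :=
  LinearMap.mk₂ K
    (fun f g => ∑ i : Fin n,
      (pderiv (Fin.castAdd n i) f * pderiv (Fin.natAdd n i) g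
        - pderiv (Fin.natAdd n i) f * pderiv (Fin.castAdd n i) g))
    (fun f f' g => by
      rw [← Finset.sum_add_distrib]
      exact Finset.sum_congr rfl fun i _ => by simp only [map_add]; ring)
    (fun c f g => by
      rw [Finset.smul_sum]
      exact Finset.sum_congr rfl fun i _ => by
        simp only [Derivation.map_smul, smul_mul_assoc, smul_sub])
    (fun f g g' => by
      rw [← Finset.sum_add_distrib]
      exact Finset.sum_congr rfl fun i _ => by simp only [map_add]; ring)
    (fun c f g => by
      rw [Finset.smul_sum]
      exact Finset.sum_congr rfl fun i _ => by
        simp only [Derivation.map_smul, mul_smul_comm, smul_sub])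

theorem classicalBracket_apply (f g : MvPolynomial (Fin (n + n)) K) :
    classicalBracket K n f g = ∑ i : Fin n,
      (pderiv (Fin.castAdd n i) f * pderiv (Fin.natAdd n i) g
        - pderiv (Fin.natAdd n i) f * pderiv (Fin.castAdd n i) g) := rfl

theorem classicalBracket_self (f : MvPolynomial (Fin (n + n)) K) :
    classicalBracket K n f f = 0 := by
  rw [classicalBracket_apply]
  exact Finset.sum_eq_zero fun i _ => by ring

theorem classicalBracket_swap (f g : MvPolynomial (Fin (n + n)) K) :
    classicalBracket K n f g = -classicalBracket K n g f := by
  rw [classicalBracket_apply, classicalBracket_apply, ← Finset.sum_neg_distrib]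
  exact Finset.sum_congr rfl fun i _ => by ring

theorem classicalBracket_leibniz (a x y : MvPolynomial (Fin (n + n)) K) :
    classicalBracket K n a (x * y)
      = classicalBracket K n a x * y + x * classicalBracket K n a y := by
  simp only [classicalBracket_apply]
  rw [Finset.sum_mul, Finset.mul_sum, ← Finset.sum_add_distrib]
  exact Finset.sum_congr rfl fun i _ => by
    simp only [Derivation.leibniz, smul_eq_mul]; ring

theorem pderiv_pderiv_swap {σ : Type*} (i j : σ) (f : MvPolynomial σ K) :
    pderiv i (pderiv j f) = pderiv j (pderiv i f) := by
  classical
  have h : ⁅(pderiv i : Derivation K (MvPolynomial σ K) (MvPolynomial σ K)),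
      (pderiv j : Derivation K (MvPolynomial σ K) (MvPolynomial σ K))⁆ = 0 :=
    MvPolynomial.derivation_ext fun k => by
      rw [Derivation.commutator_apply]
      simp [pderiv_X, Pi.single_apply, apply_ite]
  have h' := congrArg (fun D => D f) h
  rw [Derivation.commutator_apply] at h'
  exact sub_eq_zero.mp h'

theorem pderiv_classicalBracket (k : Fin (n + n)) (f g : MvPolynomial (Fin (n + n)) K) :
    pderiv k (classicalBracket K n f g)
      = classicalBracket K n (pderiv k f) g + classicalBracket K n f (pderiv k g) := by
  simp only [classicalBracket_apply]
  rw [map_sum, ← Finset.sum_add_distrib]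
  refine Finset.sum_congr rfl fun i _ => ?_
  simp only [map_sub, Derivation.leibniz, smul_eq_mul]
  rw [pderiv_pderiv_swap K k (Fin.castAdd n i) f, pderiv_pderiv_swap K k (Fin.castAdd n i) g,
    pderiv_pderiv_swap K k (Fin.natAdd n i) f, pderiv_pderiv_swap K k (Fin.natAdd n i) g]
  ring

theorem classicalBracket_X_castAdd (f : MvPolynomial (Fin (n + n)) K) (k : Fin n) :
    classicalBracket K n f (X (Fin.castAdd n k)) = -pderiv (Fin.natAdd n k) f := by
  classical
  have h : ∀ i : Fin n, Fin.castAdd n k ≠ Fin.natAdd n i := fun i h => by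
    have := congrArg Fin.val h
    simp only [Fin.val_castAdd, Fin.val_natAdd] at this; omega
  simp [classicalBracket_apply, pderiv_X, Pi.single_apply, h, -Fin.natAdd_eq_addNat]

theorem classicalBracket_X_natAdd (f : MvPolynomial (Fin (n + n)) K) (k : Fin n) :
    classicalBracket K n f (X (Fin.natAdd n k)) = pderiv (Fin.castAdd n k) f := by
  classical
  have h : ∀ i : Fin n, Fin.natAdd n k ≠ Fin.castAdd n i := fun i h => by
    have := congrArg Fin.val h
    simp only [Fin.val_castAdd, Fin.val_natAdd] at this; omega
  simp [classicalBracket_apply, pderiv_X, Pi.single_apply, h, -Fin.natAdd_eq_addNat]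

theorem classicalBracket_bracket (f g h : MvPolynomial (Fin (n + n)) K) :
    classicalBracket K n (classicalBracket K n f g) h
      = classicalBracket K n f (classicalBracket K n g h)
        - classicalBracket K n g (classicalBracket K n f h) := by
  let D (a : MvPolynomial (Fin (n + n)) K) :
      Derivation K (MvPolynomial (Fin (n + n)) K) (MvPolynomial (Fin (n + n)) K) :=
    Derivation.mk' (classicalBracket K n a) fun x y => by
      rw [classicalBracket_leibniz]; simp only [smul_eq_mul]; ring
  have key : D (classicalBracket K n f g) = ⁅D f, D g⁆ := by
    refine MvPolynomial.derivation_ext fun k => ?_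
    rw [Derivation.commutator_apply]
    change classicalBracket K n (classicalBracket K n f g) (X k)
      = classicalBracket K n f (classicalBracket K n g (X k))
        - classicalBracket K n g (classicalBracket K n f (X k))
    refine Fin.addCases (fun i => ?_) (fun i => ?_) k
    · simp only [classicalBracket_X_castAdd, pderiv_classicalBracket, map_neg]
      rw [classicalBracket_swap K n g]; ring
    · simp only [classicalBracket_X_natAdd, pderiv_classicalBracket]
      rw [classicalBracket_swap K n g]; ring
  exact congrArg (fun E => E h) key

/-- The Poisson polynomial algebra `P_{2n} = K[x_1, …, x_{2n}]` with the classical bracket. -/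
noncomputable def poissonPolynomial : PoissonStructure K (MvPolynomial (Fin (n + n)) K) where
  bracket := classicalBracket K n
  bracket_self := classicalBracket_self K n
  jacobi a b c := by
    have h := classicalBracket_bracket K n a b c
    rw [classicalBracket_swap K n c a, map_neg, classicalBracket_swap K n c, h]
    ring
  leibniz := classicalBracket_leibniz K n

end ClassicalBracket

section WeylAlgebra

variable (K : Type*) [Field K] (m : ℕ)

/-- The defining relations of the Weyl algebra `A_m`. The generator `Sum.inl i` is `x_i`, the
generator `Sum.inr i` is `∂_i`. -/
inductive WeylRel :
    FreeAlgebra K (Fin m ⊕ Fin m) → FreeAlgebra K (Fin m ⊕ Fin m) → Prop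
  | x_comm (i j : Fin m) :
      WeylRel (FreeAlgebra.ι K (Sum.inl i) * FreeAlgebra.ι K (Sum.inl j))
        (FreeAlgebra.ι K (Sum.inl j) * FreeAlgebra.ι K (Sum.inl i))
  | d_comm (i j : Fin m) :
      WeylRel (FreeAlgebra.ι K (Sum.inr i) * FreeAlgebra.ι K (Sum.inr j))
        (FreeAlgebra.ι K (Sum.inr j) * FreeAlgebra.ι K (Sum.inr i))
  | d_x (i j : Fin m) :
      WeylRel (FreeAlgebra.ι K (Sum.inr i) * FreeAlgebra.ι K (Sum.inl j)
          - FreeAlgebra.ι K (Sum.inl j) * FreeAlgebra.ι K (Sum.inr i))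
        (if i = j then 1 else 0)

/-- The `m`-th Weyl algebra `A_m` over `K`, by generators and relations. -/
abbrev WeylAlgebra : Type _ := RingQuot (WeylRel K m)

/-- The generator `x_i` of the Weyl algebra. -/
noncomputable def WeylAlgebra.x (i : Fin m) : WeylAlgebra K m :=
  RingQuot.mkAlgHom K (WeylRel K m) (FreeAlgebra.ι K (Sum.inl i))

/-- The generator `∂_i` of the Weyl algebra. -/
noncomputable def WeylAlgebra.d (i : Fin m) : WeylAlgebra K m :=
  RingQuot.mkAlgHom K (WeylRel K m) (FreeAlgebra.ι K (Sum.inr i))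

end WeylAlgebra

section GelfandKirillov

/-- The degree `γ(f) = inf {r ∈ ℝ | f(i) ≤ i^r for all large i}` of a function `f : ℕ → ℕ`, an
extended real number (equal to `⊤` if there is no such `r`). -/
noncomputable def growthDegree (f : ℕ → ℕ) : EReal :=
  sInf {s : EReal | ∃ r : ℝ, s = (r : EReal) ∧
    ∀ᶠ i : ℕ in Filter.atTop, (f i : ℝ) ≤ (i : ℝ) ^ r}

/-- For a subset `S` of a `K`-algebra `A`, the `i`-th term `A_i = (K + K S)^i` of the standard
filtration of the subalgebra generated by `S`. -/
def standardFiltration (K : Type*) {A : Type*} [Field K] [Ring A] [Algebra K A]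
    (S : Set A) (i : ℕ) : Submodule K A :=
  (1 ⊔ Submodule.span K S) ^ i

/-- The Gelfand-Kirillov dimension of a `K`-algebra `A`, finitely generated or not: the supremum
over all finite subsets `S` of `A` of the degree of `i ↦ dim_K (K + K S)^i`. If `A` is finitely
generated, this is the degree for any finite generating set. -/
noncomputable def gkDim (K A : Type*) [Field K] [Ring A] [Algebra K A] : EReal :=
  ⨆ S : Finset A, growthDegree fun i => Module.finrank K (standardFiltration K (S : Set A) i)

end GelfandKirillov

/-! ### Normally ordered operators and their injectivity -/

section NormalOrdering

open MvPolynomial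

/-! Everything rests on normal ordering: writing operators with coefficients on the left and
derivations on the right. The resulting linear map from `P[ξ]` is injective when the derivations are
linearly independent over `P` (`normalOrder_injective`): to leading order, the commutator with `b`
is `∑ u_i(b) ∂/∂ξ_i`, so in characteristic zero a relation forces relations of lower degree.

With `u_i = ∂_i` this gives the normal form of the Weyl algebra. Commutators with `x_j` and `∂_j`
differentiate normal forms, whence simplicity and centre `K`. By simplicity the polynomial
representation is faithful, and its image is `A(P)`. With `u_i = {a_i, ·}` it gives condition (3) of
strong simplicity, independence of these derivations being the Jacobian criterion.

For isotropic subalgebras, the gradients and the Hamiltonian vectors of `m` independent commuting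
elements span spaces of dimension `m` that annihilate each other in dimension `2n`, so `m ≤ n`.
Noether normalization turns this into the bound on the Gelfand-Kirillov dimension. -/

/-- Pairwise commuting elements of an algebra are the images of the variables under an algebra
homomorphism from a polynomial algebra. -/
theorem MvPolynomial.exists_algHom_of_commute {K A ι : Type*} [Field K] [Ring A] [Algebra K A]
    (b : ι → A) (h : ∀ i j, b i * b j = b j * b i) :
    ∃ φ : MvPolynomial ι K →ₐ[K] A, ∀ i, φ (X i) = b i := by
  have hc : ∀ x ∈ Set.range b, ∀ y ∈ Set.range b, x * y = y * x := by
    rintro _ ⟨i, rfl⟩ _ ⟨j, rfl⟩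
    exact h i j
  have := Algebra.isMulCommutative_adjoin K hc
  let _ : CommRing (Algebra.adjoin K (Set.range b)) :=
    { (inferInstance : Ring (Algebra.adjoin K (Set.range b))) with
      mul_comm := fun x y => mul_comm' x y }
  let b' : ι → Algebra.adjoin K (Set.range b) :=
    fun i => ⟨b i, Algebra.subset_adjoin ⟨i, rfl⟩⟩
  exact ⟨(Algebra.adjoin K (Set.range b)).val.comp (aeval b'), fun i => by simp [b']⟩

variable {K P A B σ : Type*} [Field K] [CommRing P] [Algebra K P] [Ring A] [Algebra K A]
  [Ring B] [Algebra K B]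

/-- The `K`-linear map `P[ξ] → A` that sends `p ξ^β` to `f p * g (ξ^β)`. -/
noncomputable def normalOrder (f : P →ₐ[K] A) (g : MvPolynomial σ K →ₐ[K] A) :
    MvPolynomial σ P →ₗ[K] A :=
  TensorProduct.lift ((LinearMap.mul K A).compl₁₂ f.toLinearMap g.toLinearMap) ∘ₗ
    ((algebraTensorAlgEquiv K P (σ := σ)).symm.toLinearMap.restrictScalars K)

theorem normalOrder_monomial (f : P →ₐ[K] A) (g : MvPolynomial σ K →ₐ[K] A) (m : σ →₀ ℕ) (p : P) :
    normalOrder f g (monomial m p) = f p * g (monomial m 1) := by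
  simp [normalOrder]

theorem normalOrder_C (f : P →ₐ[K] A) (g : MvPolynomial σ K →ₐ[K] A) (p : P) :
    normalOrder f g (C p) = f p := by
  rw [C_apply, normalOrder_monomial, show monomial (0 : σ →₀ ℕ) (1 : K) = 1 from rfl, map_one,
    mul_one]

/-- Normal ordering is not multiplicative in general. It respects only coefficients multiplied on
the left and, in `normalOrder_mul_X`, variables multiplied on the right. -/
theorem normalOrder_C_mul (f : P →ₐ[K] A) (g : MvPolynomial σ K →ₐ[K] A) (p : P)
    (Q : MvPolynomial σ P) : normalOrder f g (C p * Q) = f p * normalOrder f g Q := by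
  induction Q using MvPolynomial.induction_on' with
  | monomial m a => rw [C_mul_monomial, normalOrder_monomial, normalOrder_monomial, map_mul,
      mul_assoc]
  | add p q hp hq => rw [mul_add, map_add, map_add, mul_add, hp, hq]

theorem normalOrder_mul_X (f : P →ₐ[K] A) (g : MvPolynomial σ K →ₐ[K] A) (i : σ)
    (Q : MvPolynomial σ P) : normalOrder f g (Q * X i) = normalOrder f g Q * g (X i) := by
  induction Q using MvPolynomial.induction_on' with
  | monomial m a =>
    rw [X, monomial_mul, normalOrder_monomial, normalOrder_monomial, mul_one, mul_assoc,
      X, ← map_mul, monomial_mul, mul_one]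
  | add p q hp hq => rw [add_mul, map_add, map_add, add_mul, hp, hq]

theorem map_normalOrder (e : A →ₐ[K] B) (f : P →ₐ[K] A) (g : MvPolynomial σ K →ₐ[K] A)
    (Q : MvPolynomial σ P) :
    e (normalOrder f g Q) = normalOrder (e.comp f) (e.comp g) Q := by
  induction Q using MvPolynomial.induction_on' with
  | monomial m a => simp [normalOrder_monomial]
  | add p q hp hq => rw [map_add, map_add, map_add, hp, hq]

variable (P σ) in
/-- The polynomials of total degree less than `k`. -/
def degreeBelow (k : ℕ) : Submodule P (MvPolynomial σ P) where
  carrier := {Q | ∀ β : σ →₀ ℕ, k ≤ β.degree → coeff β Q = 0}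
  add_mem' ha hb β hβ := by rw [coeff_add, ha β hβ, hb β hβ, add_zero]
  zero_mem' β _ := coeff_zero β
  smul_mem' c Q hQ β hβ := by rw [coeff_smul, hQ β hβ, smul_zero]

theorem degreeBelow_mono {k l : ℕ} (h : k ≤ l) : degreeBelow P σ k ≤ degreeBelow P σ l :=
  fun _ hQ β hβ => hQ β (h.trans hβ)

theorem degreeBelow_zero {Q : MvPolynomial σ P} (h : Q ∈ degreeBelow P σ 0) : Q = 0 :=
  MvPolynomial.ext _ _ fun β => by rw [h β (Nat.zero_le _), coeff_zero]

theorem mul_X_mem_degreeBelow {k : ℕ} {Q : MvPolynomial σ P} (h : Q ∈ degreeBelow P σ k) (i : σ) :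
    Q * X i ∈ degreeBelow P σ (k + 1) := by
  classical
  intro β hβ
  rw [coeff_mul_X']
  split_ifs with hi
  · refine h _ ?_
    have h1 : Finsupp.single i 1 ≤ β := by
      rw [Finsupp.single_le_iff]
      exact Nat.one_le_iff_ne_zero.mpr (Finsupp.mem_support_iff.mp hi)
    have h2 := congrArg Finsupp.degree (tsub_add_cancel_of_le h1)
    rw [map_add, Finsupp.degree_single] at h2
    omega
  · rfl

theorem C_mul_mem_degreeBelow {k : ℕ} {Q : MvPolynomial σ P} (h : Q ∈ degreeBelow P σ k) (p : P) :
    C p * Q ∈ degreeBelow P σ k := by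
  rw [C_mul']
  exact Submodule.smul_mem _ _ h

theorem pderiv_mem_degreeBelow {k : ℕ} {Q : MvPolynomial σ P} (h : Q ∈ degreeBelow P σ (k + 1))
    (i : σ) : pderiv i Q ∈ degreeBelow P σ k := by
  intro β hβ
  rw [coeff_pderiv, h, zero_mul]
  rw [map_add, Finsupp.degree_single]
  omega

theorem exists_mem_degreeBelow (Q : MvPolynomial σ P) : ∃ k, Q ∈ degreeBelow P σ k := by
  refine ⟨Q.totalDegree + 1, fun β hβ => coeff_eq_zero_of_totalDegree_lt ?_⟩
  rw [Finsupp.degree_apply] at hβ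
  exact hβ

/-- The leading part of the commutator of a normally ordered monomial with a coefficient. -/
theorem exists_normalOrder_commutator_monomial [Fintype σ] (f : P →ₐ[K] A)
    (g : MvPolynomial σ K →ₐ[K] A) (u : σ → Derivation K P P)
    (hu : ∀ i b, g (X i) * f b = f b * g (X i) + f (u i b)) (β : σ →₀ ℕ) :
    ∀ b : P, ∃ R ∈ degreeBelow P σ (β.degree - 1),
      normalOrder f g (monomial β 1) * f b - f b * normalOrder f g (monomial β 1)
        = normalOrder f g (∑ i, C (u i b) * pderiv i (monomial β 1) + R) := by
  classical
  obtain ⟨d, hd⟩ : ∃ d, β.degree = d := ⟨_, rfl⟩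
  induction d generalizing β with
  | zero =>
    intro b
    refine ⟨0, Submodule.zero_mem _, ?_⟩
    obtain rfl : β = 0 := (Finsupp.degree_eq_zero_iff β).mp hd
    have h1 : normalOrder f g (monomial (0 : σ →₀ ℕ) (1 : P)) = 1 := by
      rw [← C_apply, normalOrder_C, map_one]
    have h2 : ∀ i, pderiv i (monomial (0 : σ →₀ ℕ) (1 : P)) = 0 := fun i => pderiv_C
    rw [h1, one_mul, mul_one, sub_self]
    simp only [h2, mul_zero, Finset.sum_const_zero, add_zero, map_zero]
  | succ d ih =>
    intro b
    obtain ⟨i, hi⟩ : ∃ i, β i ≠ 0 := by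
      by_contra! h
      rw [show β = 0 from Finsupp.ext h, map_zero] at hd
      omega
    obtain ⟨γ, rfl⟩ : ∃ γ, β = γ + Finsupp.single i 1 :=
      ⟨β - Finsupp.single i 1, (tsub_add_cancel_of_le (Finsupp.single_le_iff.mpr
        (Nat.one_le_iff_ne_zero.mpr hi))).symm⟩
    rw [map_add, Finsupp.degree_single] at hd
    have hγ : γ.degree = d := by omega
    have hM : monomial (γ + Finsupp.single i 1) (1 : P) = monomial γ 1 * X i := by
      rw [monomial_add_single, pow_one]
    set M : MvPolynomial σ P := monomial γ 1 with hMdef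
    have hMd : M ∈ degreeBelow P σ (d + 1) := fun β hβ => by
      rw [hMdef, coeff_monomial, if_neg]
      rintro rfl
      omega
    -- Moving `g (X i)` past `f b` creates `f (u i b)`, so the hypothesis is needed for both
    -- elements.
    obtain ⟨R, hR, hR'⟩ := ih γ hγ b
    obtain ⟨S, hS, hS'⟩ := ih γ hγ (u i b)
    rw [hγ] at hR hS
    -- The whole commutator with `u i b` is already of lower order and joins the remainder.
    refine ⟨R * X i + (∑ k, C (u k (u i b)) * pderiv k M + S), ?_, ?_⟩
    · rw [map_add, Finsupp.degree_single, hγ, Nat.add_sub_cancel]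
      refine add_mem ?_ (add_mem (sum_mem fun k _ => ?_) (degreeBelow_mono (Nat.sub_le _ _) hS))
      -- For `d = 0` the subtraction `d - 1` truncates, but then `R` vanishes.
      · rcases d with _ | d
        · rw [degreeBelow_zero hR, zero_mul]
          exact zero_mem _
        · exact mul_X_mem_degreeBelow hR i
      · exact C_mul_mem_degreeBelow (pderiv_mem_degreeBelow hMd k) _
    · have h1 : ∑ k, C (u k b) * pderiv k (M * X i)
          = (∑ k, C (u k b) * pderiv k M) * X i + C (u i b) * M := by
        have h : ∀ k, C (u k b) * pderiv k (M * X i)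
            = C (u k b) * pderiv k M * X i + if k = i then C (u k b) * M else 0 := fun k => by
          rw [Derivation.leibniz, pderiv_X, Pi.single_apply]
          simp only [smul_eq_mul, eq_comm (a := i)]
          split_ifs <;> ring
        rw [Finset.sum_congr rfl fun k _ => h k, Finset.sum_add_distrib, Finset.sum_mul,
          Finset.sum_ite_eq' Finset.univ i, if_pos (Finset.mem_univ i)]
      rw [hM, h1]
      have h2 : normalOrder f g (M * X i) * f b - f b * normalOrder f g (M * X i)
          = (normalOrder f g M * f b - f b * normalOrder f g M) * g (X i)
            + f (u i b) * normalOrder f g M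
            + (normalOrder f g M * f (u i b) - f (u i b) * normalOrder f g M) := by
        rw [normalOrder_mul_X, mul_assoc, hu]
        noncomm_ring
      rw [h2, hR', hS', ← normalOrder_mul_X, ← normalOrder_C_mul, ← map_add, ← map_add]
      congr 1
      ring

/-- The images of coefficients commute with `f b`, so the monomial case extends by left linearity.
-/
theorem exists_normalOrder_commutator [Fintype σ] (f : P →ₐ[K] A)
    (g : MvPolynomial σ K →ₐ[K] A) (u : σ → Derivation K P P)
    (hu : ∀ i b, g (X i) * f b = f b * g (X i) + f (u i b)) {d : ℕ} {Q : MvPolynomial σ P}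
    (hQ : Q ∈ degreeBelow P σ (d + 1)) (b : P) :
    ∃ R ∈ degreeBelow P σ (d - 1),
      normalOrder f g Q * f b - f b * normalOrder f g Q
        = normalOrder f g (∑ i, C (u i b) * pderiv i Q + R) := by
  classical
  have hsum : ∀ T : Finset (σ →₀ ℕ), T ⊆ Q.support → ∃ R ∈ degreeBelow P σ (d - 1),
      normalOrder f g (∑ β ∈ T, monomial β (coeff β Q)) * f b
          - f b * normalOrder f g (∑ β ∈ T, monomial β (coeff β Q))
        = normalOrder f g
            (∑ i, C (u i b) * pderiv i (∑ β ∈ T, monomial β (coeff β Q)) + R) := by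
    intro T
    induction T using Finset.induction_on with
    | empty => exact fun _ => ⟨0, zero_mem _, by simp⟩
    | insert β T hβT ih =>
      intro hT
      obtain ⟨R₁, h₁, e₁⟩ := ih ((Finset.subset_insert _ _).trans hT)
      have hβd : β.degree < d + 1 := by
        by_contra! h
        exact mem_support_iff.mp (hT (Finset.mem_insert_self _ _)) (hQ β h)
      obtain ⟨R, hR, hR'⟩ := exists_normalOrder_commutator_monomial f g u hu β b
      refine ⟨C (coeff β Q) * R + R₁, add_mem
        (C_mul_mem_degreeBelow (degreeBelow_mono (by omega) hR) _) h₁, ?_⟩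
      rw [Finset.sum_insert hβT]
      generalize ∑ β ∈ T, monomial β (coeff β Q) = S at e₁ ⊢
      generalize coeff β Q = c
      have h1 : monomial β c = C c * monomial β 1 := by
        rw [C_mul_monomial, mul_one]
      have h2 : ∑ i, C (u i b) * pderiv i (monomial β c + S) + (C c * R + R₁)
          = C c * (∑ i, C (u i b) * pderiv i (monomial β 1) + R)
            + (∑ i, C (u i b) * pderiv i S + R₁) := by
        have h : ∀ i, C (u i b) * pderiv i (monomial β c + S)
            = C c * (C (u i b) * pderiv i (monomial β 1)) + C (u i b) * pderiv i S := fun i => by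
          rw [map_add, h1, pderiv_C_mul]
          ring
        rw [Finset.sum_congr rfl fun i _ => h i, Finset.sum_add_distrib, ← Finset.mul_sum]
        ring
      have h3 : f c * f b = f b * f c := by rw [← map_mul, mul_comm, map_mul]
      rw [h2, map_add, map_add (normalOrder f g) (C c * _), normalOrder_C_mul, ← hR', ← e₁, h1, normalOrder_C_mul, mul_sub,
        ← mul_assoc (f c) (f b), h3, add_mul, mul_add, mul_assoc, mul_assoc, add_sub_add_comm]
  have h := hsum Q.support subset_rfl
  rwa [← Q.as_sum] at h

/-- Normal ordering is injective if the commutators with the coefficients are given by linearly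
independent derivations. -/
theorem normalOrder_injective [IsDomain P] [CharZero P] [Fintype σ] (f : P →ₐ[K] A)
    (g : MvPolynomial σ K →ₐ[K] A) (u : σ → Derivation K P P)
    (hu : ∀ i b, g (X i) * f b = f b * g (X i) + f (u i b))
    (hf : Function.Injective f) (hli : ∀ p : σ → P, (∀ b, ∑ i, u i b * p i = 0) → p = 0) :
    Function.Injective (normalOrder f g) := by
  classical
  have key : ∀ d, ∀ Q ∈ degreeBelow P σ d, normalOrder f g Q = 0 → Q = 0 := by
    intro d
    induction d with
    | zero => exact fun Q hQ _ => degreeBelow_zero hQ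
    | succ d ih =>
      intro Q hQ h0
      rcases d with _ | d
      · have hC : Q = C (coeff 0 Q) := by
          ext β
          rw [coeff_C]
          split_ifs with h
          · rw [h]
          · refine hQ β (Nat.one_le_iff_ne_zero.mpr fun h' => h ?_)
            exact ((Finsupp.degree_eq_zero_iff β).mp h').symm
        rw [hC, normalOrder_C] at h0
        rw [hC, (map_eq_zero_iff f hf).mp h0, C_0]
      · refine ih Q (fun β hβ => ?_) h0
        rcases hβ.eq_or_lt with hβ | hβ
        swap
        · exact hQ β hβ
        obtain ⟨i, hi⟩ : ∃ i, β i ≠ 0 := by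
          by_contra! h
          rw [show β = 0 from Finsupp.ext h, map_zero] at hβ
          omega
        obtain ⟨γ, rfl⟩ : ∃ γ, β = γ + Finsupp.single i 1 :=
          ⟨β - Finsupp.single i 1, (tsub_add_cancel_of_le (Finsupp.single_le_iff.mpr
            (Nat.one_le_iff_ne_zero.mpr hi))).symm⟩
        have hγ : γ.degree = d := by
          rw [map_add, Finsupp.degree_single] at hβ
          omega
        -- The commutator with `f b` is zero and comes from a polynomial of lower degree, which
        -- vanishes by induction. Its coefficient at `γ` misses `R` and is a relation between the `u
        -- k b`.
        have h1 : (fun k => coeff γ (pderiv k Q)) = 0 := by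
          refine hli _ fun b => ?_
          obtain ⟨R, hR, hR'⟩ := exists_normalOrder_commutator f g u hu hQ b
          rw [h0, zero_mul, mul_zero, sub_zero] at hR'
          have h2 := ih _ (add_mem (sum_mem fun k _ => C_mul_mem_degreeBelow
            (pderiv_mem_degreeBelow hQ k) _) (degreeBelow_mono (Nat.sub_le _ _) hR)) hR'.symm
          have h3 := congrArg (coeff γ) h2
          rw [coeff_add, coeff_sum, hR γ (by omega), add_zero, coeff_zero] at h3
          simpa only [coeff_C_mul] using h3
        have h4 := congrFun h1 i
        simp only [coeff_pderiv, Pi.zero_apply] at h4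
        -- Characteristic zero: the factor `γ i + 1` produced by differentiation is not zero.
        exact (mul_eq_zero.mp h4).resolve_right (Nat.cast_add_one_ne_zero _)
  rw [injective_iff_map_eq_zero]
  intro Q hQ
  obtain ⟨d, hd⟩ := exists_mem_degreeBelow Q
  exact key d Q hd hQ

theorem MvPolynomial.eq_C_of_pderiv_eq_zero {R σ : Type*} [CommRing R] [IsDomain R] [CharZero R]
    {Q : MvPolynomial σ R} (h : ∀ i, pderiv i Q = 0) : Q = C (coeff 0 Q) := by
  classical
  ext β
  rw [coeff_C]
  split_ifs with hβ
  · rw [hβ]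
  · obtain ⟨i, hi⟩ : ∃ i, β i ≠ 0 := by
      by_contra! h
      exact hβ (Finsupp.ext h).symm
    have h1 := congrArg (coeff (β - Finsupp.single i 1)) (h i)
    rw [coeff_pderiv, coeff_zero, tsub_add_cancel_of_le (Finsupp.single_le_iff.mpr
        (Nat.one_le_iff_ne_zero.mpr hi))] at h1
    exact (mul_eq_zero.mp h1).resolve_right (Nat.cast_add_one_ne_zero _)

/-- A nonzero set of polynomials that is closed under partial derivatives contains a nonzero
constant. -/
theorem MvPolynomial.exists_C_mem_of_pderiv_mem {R σ : Type*} [CommRing R] [IsDomain R]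
    [CharZero R] (V : Set (MvPolynomial σ R)) (hV : ∀ Q ∈ V, ∀ i, pderiv i Q ∈ V)
    {Q : MvPolynomial σ R} (hQ : Q ∈ V) (h0 : Q ≠ 0) : ∃ c : R, c ≠ 0 ∧ C c ∈ V := by
  obtain ⟨d, hd⟩ := exists_mem_degreeBelow Q
  induction d generalizing Q with
  | zero => exact absurd (degreeBelow_zero hd) h0
  | succ d ih =>
    by_cases h : ∀ i, pderiv i Q = 0
    · have h1 := eq_C_of_pderiv_eq_zero h
      refine ⟨coeff 0 Q, fun h2 => h0 ?_, h1 ▸ hQ⟩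
      rw [h1, h2, C_0]
    · push Not at h
      obtain ⟨i, hi⟩ := h
      exact ih (hV Q hQ i) hi (pderiv_mem_degreeBelow hd i)

end NormalOrdering

/-! ### The Jacobian criterion through Kähler differentials -/

section Jacobian

open scoped IntermediateField.algebraAdjoinAdjoin

/-- In characteristic zero, the differentials of algebraically independent elements of a finitely
generated field extension are linearly independent. -/
theorem AlgebraicIndependent.linearIndependent_D {K L ι : Type*} [Field K] [CharZero K] [Field L]
    [Algebra K L] [Algebra.EssFiniteType K L] {a : ι → L} (ha : AlgebraicIndependent K a) :
    LinearIndependent L fun i => KaehlerDifferential.D K L (a i) := by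
  let F := IntermediateField.adjoin K (Set.range a)
  have : CharZero F := charZero_of_injective_algebraMap (algebraMap K F).injective
  have : Algebra.EssFiniteType F L := .of_comp K F L
  let R := MvPolynomial ι K
  let A := Algebra.adjoin K (Set.range a)
  have : Algebra.FormallySmooth A F := .of_isLocalization (nonZeroDivisors A)
  -- `F` is a localization of `A`, and `L` is formally smooth over `F` in characteristic zero.
  have : Algebra.FormallySmooth A L := .comp A F L
  let _ : Algebra R A := ha.aevalEquiv.toAlgHom.toAlgebra
  let _ : Algebra R L := (MvPolynomial.aeval a).toAlgebra
  have : IsScalarTower K R L := .of_algebraMap_eq' (MvPolynomial.aeval a).comp_algebraMap.symm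
  have : IsScalarTower R A L := .of_algebraMap_eq fun x => (ha.algebraMap_aevalEquiv x).symm
  have : Algebra.FormallySmooth R A :=
    .of_equiv (AlgEquiv.ofBijective (Algebra.ofId R A) ha.aevalEquiv.bijective)
  have : Algebra.FormallySmooth R L := .comp R A L
  -- The kernel is the image of the first cotangent homology of `L` over `R`, which formal
  -- smoothness kills.
  have hinj : LinearMap.ker (KaehlerDifferential.mapBaseChange K R L) = ⊥ := by
    rw [LinearMap.ker_eq_bot']
    intro x hx
    obtain ⟨y, rfl⟩ := (Algebra.H1Cotangent.exact_δ_mapBaseChange K R L x).mp hx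
    rw [Subsingleton.elim y 0, map_zero]
  have h := ((KaehlerDifferential.mvPolynomialBasis K ι).baseChange L).linearIndependent.map' _ hinj
  convert! h using 2 with i
  rw [Function.comp_apply, Module.Basis.baseChange_apply,
    KaehlerDifferential.mvPolynomialBasis_apply, KaehlerDifferential.mapBaseChange_tmul, one_smul,
    KaehlerDifferential.map_D]
  exact congrArg _ (MvPolynomial.aeval_X a i).symm

/-- The Jacobian criterion: the gradients of algebraically independent polynomials are linearly
independent over the field of fractions. -/
theorem AlgebraicIndependent.linearIndependent_pderiv {K σ ι : Type*} [Field K] [CharZero K]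
    [Finite σ] {a : ι → MvPolynomial σ K} (ha : AlgebraicIndependent K a) :
    LinearIndependent (FractionRing (MvPolynomial σ K)) fun i k =>
      algebraMap (MvPolynomial σ K) (FractionRing (MvPolynomial σ K))
        (MvPolynomial.pderiv k (a i)) := by
  classical
  have := Fintype.ofFinite σ
  let L := FractionRing (MvPolynomial σ K)
  have : Algebra.EssFiniteType (MvPolynomial σ K) L := .of_isLocalization _ (nonZeroDivisors _)
  have : Algebra.EssFiniteType K L := .comp K (MvPolynomial σ K) L
  let v : σ → Ω[L⁄K] := fun k =>
    KaehlerDifferential.D K L (algebraMap (MvPolynomial σ K) L (MvPolynomial.X k))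
  -- The map sending the `k`-th unit vector to `dx_k` takes each gradient to the differential
  -- `da_i`, by the chain rule; independence is tested there.
  refine LinearIndependent.of_comp (Fintype.linearCombination L v) ?_
  have h := (ha.map' (f := IsScalarTower.toAlgHom K (MvPolynomial σ K) L)
    (FaithfulSMul.algebraMap_injective _ _)).linearIndependent_D
  convert! h using 2 with i
  let E : Derivation K (MvPolynomial σ K) Ω[L⁄K] :=
    ∑ k, (LinearMap.toSpanSingleton (MvPolynomial σ K) Ω[L⁄K] (v k)).compDer (MvPolynomial.pderiv k)
  have hE : ∀ p, E p = ∑ k, MvPolynomial.pderiv k p • v k := fun p => by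
    have h1 := map_sum (Derivation.coeFnAddMonoidHom (R := K) (A := MvPolynomial σ K)
      (M := Ω[L⁄K])) (fun k => (LinearMap.toSpanSingleton (MvPolynomial σ K) Ω[L⁄K] (v k)).compDer
        (MvPolynomial.pderiv k)) Finset.univ
    have h2 := congrFun h1 p
    rw [Finset.sum_apply] at h2
    exact h2
  have key : (KaehlerDifferential.D K L).compAlgebraMap (MvPolynomial σ K) = E := by
    refine MvPolynomial.derivation_ext fun j => ?_
    rw [hE]
    simp [MvPolynomial.pderiv_X, Pi.single_apply, v]
  have h1 : KaehlerDifferential.D K L (algebraMap _ L (a i)) = E (a i) :=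
    congrArg (fun E => E (a i)) key
  rw [Function.comp_apply, Fintype.linearCombination_apply]
  refine (Finset.sum_congr rfl fun k _ => ?_).trans ((hE _).symm.trans h1.symm)
  exact algebraMap_smul L _ _

end Jacobian

/-! ### Growth of commutative algebras -/

section GrowthBound

/-- For each real `r > n`, the factor `i ^ (r - n)` eventually exceeds any constant. -/
theorem growthDegree_le {f : ℕ → ℕ} {n s D t : ℕ} (hs : s ≤ n)
    (hf : ∀ i, f i ≤ t * (D * (i + 1) + 1) ^ s) : growthDegree f ≤ ((n : ℕ) : EReal) := by
  refine EReal.le_of_forall_lt_iff_le.mp fun r hr => sInf_le ⟨r, rfl, ?_⟩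
  have hr' : (n : ℝ) < r := by exact_mod_cast hr
  have h1 := (tendsto_rpow_atTop (sub_pos.mpr hr')).comp tendsto_natCast_atTop_atTop
  filter_upwards [h1.eventually_ge_atTop ((t * (2 * D + 1) ^ s : ℕ) : ℝ),
    Filter.eventually_ge_atTop 1] with i hi hi1
  have h2 : f i ≤ t * (2 * D + 1) ^ s * i ^ n := by
    calc f i ≤ t * (D * (i + 1) + 1) ^ s := hf i
      _ ≤ t * ((2 * D + 1) * i) ^ s := by
        gcongr
        nlinarith
      _ = t * (2 * D + 1) ^ s * i ^ s := by rw [mul_pow, mul_assoc]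
      _ ≤ t * (2 * D + 1) ^ s * i ^ n := by gcongr
  have hi0 : (0 : ℝ) < i := by exact_mod_cast hi1
  calc (f i : ℝ) ≤ ((t * (2 * D + 1) ^ s : ℕ) : ℝ) * (i : ℝ) ^ n := by exact_mod_cast h2
    _ ≤ (i : ℝ) ^ (r - n) * (i : ℝ) ^ n := by gcongr; exact hi
    _ = (i : ℝ) ^ r := by rw [← Real.rpow_natCast, ← Real.rpow_add hi0, sub_add_cancel]

/-- The span of the products `y^β e_l` where all exponents are at most `d`. -/
def boxSpan (K : Type*) {A : Type*} [Field K] [CommRing A] [Algebra K A] {s t : ℕ}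
    (y : Fin s → A) (e : Fin t → A) (d : ℕ) : Submodule K A :=
  Submodule.span K (Set.range fun x : (Fin s → Fin (d + 1)) × Fin t =>
    (∏ i, y i ^ (x.1 i : ℕ)) * e x.2)

variable {K A : Type*} [Field K] [CommRing A] [Algebra K A] {s t : ℕ} {y : Fin s → A}
  {e : Fin t → A}

theorem finrank_boxSpan_le (d : ℕ) : Module.finrank K (boxSpan K y e d) ≤ t * (d + 1) ^ s := by
  refine (finrank_range_le_card _).trans_eq ?_
  simp [mul_comm]

instance (d : ℕ) : Module.Finite K (boxSpan K y e d) :=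
  Module.Finite.span_of_finite K (Set.finite_range _)

theorem mem_boxSpan {d : ℕ} (β : Fin s → ℕ) (hβ : ∀ i, β i ≤ d) (l : Fin t) :
    (∏ i, y i ^ β i) * e l ∈ boxSpan K y e d :=
  Submodule.subset_span ⟨(fun i => ⟨β i, Nat.lt_succ_of_le (hβ i)⟩, l), rfl⟩

theorem prod_pow_mul_mem_boxSpan {d D : ℕ} (β : Fin s → ℕ) (hβ : ∀ i, β i ≤ d) {x : A}
    (hx : x ∈ boxSpan K y e D) : (∏ i, y i ^ β i) * x ∈ boxSpan K y e (d + D) := by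
  induction hx using Submodule.span_induction with
  | mem x hx =>
    obtain ⟨⟨γ, l⟩, rfl⟩ := hx
    simp only
    rw [← mul_assoc, ← Finset.prod_mul_distrib]
    simp only [← pow_add]
    exact mem_boxSpan (fun i => β i + γ i)
      (fun i => add_le_add (hβ i) (Nat.lt_succ_iff.mp (γ i).2)) l
  | zero => rw [mul_zero]; exact zero_mem _
  | add x x' _ _ h h' => rw [mul_add]; exact add_mem h h'
  | smul c x _ h => rw [mul_smul_comm]; exact Submodule.smul_mem _ c h

theorem boxSpan_mono {d D : ℕ} (h : d ≤ D) : boxSpan K y e d ≤ boxSpan K y e D := by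
  refine Submodule.span_le.mpr ?_
  rintro _ ⟨⟨γ, l⟩, rfl⟩
  exact mem_boxSpan (fun i => γ i) (fun i => (Nat.lt_succ_iff.mp (γ i).2).trans h) l

/-- Since `w` commutes past the monomials in `y`, the box grows by an amount independent of `d`.
Repeated multiplication therefore enlarges it only linearly. -/
theorem mul_mem_boxSpan {d D : ℕ} {w : A} (hw : ∀ l, w * e l ∈ boxSpan K y e D) {x : A}
    (hx : x ∈ boxSpan K y e d) : w * x ∈ boxSpan K y e (d + D) := by
  induction hx using Submodule.span_induction with
  | mem x hx =>
    obtain ⟨⟨γ, l⟩, rfl⟩ := hx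
    simp only
    rw [mul_left_comm]
    exact prod_pow_mul_mem_boxSpan (fun i => γ i) (fun i => Nat.lt_succ_iff.mp (γ i).2) (hw l)
  | zero => rw [mul_zero]; exact zero_mem _
  | add x x' _ _ h h' => rw [mul_add]; exact add_mem h h'
  | smul c x _ h => rw [mul_smul_comm]; exact Submodule.smul_mem _ c h

/-- Each factor costs `D`; the extra `D` in `D * (i + 1)` accommodates the unit at `i = 0`. -/
theorem standardFiltration_le_boxSpan {S : Set A} {D : ℕ} (h1 : 1 ∈ boxSpan K y e D)
    (hS : ∀ w ∈ S, ∀ l, w * e l ∈ boxSpan K y e D) (i : ℕ) :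
    standardFiltration K S i ≤ boxSpan K y e (D * (i + 1)) := by
  induction i with
  | zero =>
    rw [standardFiltration, pow_zero, Submodule.one_le, zero_add, mul_one]
    exact h1
  | succ i ih =>
    rw [standardFiltration, pow_succ', Submodule.mul_le]
    intro w hw x hx
    have hx' := ih hx
    rw [mul_add D (i + 1), mul_one]
    rw [Submodule.one_eq_span, ← Submodule.span_union] at hw
    induction hw using Submodule.span_induction with
    | mem w hw =>
      rcases hw with rfl | hw
      · rw [one_mul]
        exact boxSpan_mono (Nat.le_add_right _ _) hx'
      · exact mul_mem_boxSpan (hS w hw) hx'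
    | zero => rw [zero_mul]; exact zero_mem _
    | add x x' _ _ h h' => rw [add_mul]; exact add_mem h h'
    | smul c x _ h => rw [smul_mul_assoc]; exact Submodule.smul_mem _ c h

theorem exists_aeval_mul_mem_boxSpan (q : MvPolynomial (Fin s) K) (l : Fin t) :
    ∃ d, MvPolynomial.aeval y q * e l ∈ boxSpan K y e d := by
  induction q using MvPolynomial.induction_on' with
  | monomial β c =>
    refine ⟨β.degree, ?_⟩
    rw [MvPolynomial.aeval_monomial, mul_assoc, ← Algebra.smul_def, Finsupp.prod_fintype _ _
      (fun i => pow_zero _)]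
    exact Submodule.smul_mem _ _ (mem_boxSpan _ (fun i => Finsupp.le_degree i β) l)
  | add p q hp hq =>
    obtain ⟨d, hd⟩ := hp
    obtain ⟨d', hd'⟩ := hq
    refine ⟨max d d', ?_⟩
    rw [map_add, add_mul]
    exact add_mem (boxSpan_mono (le_max_left _ _) hd) (boxSpan_mono (le_max_right _ _) hd')

/-- The Gelfand-Kirillov dimension of a commutative algebra is bounded by the cardinality of
its algebraically independent families. -/
theorem gkDim_le_of_algebraicIndependent [Nontrivial A] {n : ℕ}
    (h : ∀ (m : ℕ) (a : Fin m → A), AlgebraicIndependent K a → m ≤ n) :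
    gkDim K A ≤ ((n : ℕ) : EReal) := by
  refine iSup_le fun S => ?_
  let R := Algebra.adjoin K (S : Set A)
  have : Algebra.FiniteType K R := R.fg_iff_finiteType.mp ⟨S, rfl⟩
  -- Noether normalization: `R` is finite over a polynomial subalgebra, whose number of variables
  -- `s` governs the growth.
  obtain ⟨s, g, hg, hfin⟩ := exists_finite_inj_algHom_of_fg K R
  let y : Fin s → A := fun i => g (MvPolynomial.X i)
  have hy : ∀ q, MvPolynomial.aeval y q = (g q : A) := fun q => by
    have : MvPolynomial.aeval y = R.val.comp g := MvPolynomial.algHom_ext fun i => by simp [y]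
    rw [this]
    rfl
  have hs : s ≤ n := h s y fun p q hpq => hg (Subtype.ext (by rw [← hy, ← hy, hpq]))
  let _ := g.toRingHom.toAlgebra
  have : Module.Finite (MvPolynomial (Fin s) K) R := hfin
  obtain ⟨t, e, he⟩ := Module.Finite.exists_fin (R := MvPolynomial (Fin s) K) (M := R)
  let e' : Fin t → A := fun l => e l
  have hR : ∀ x : R, ∃ d, (x : A) ∈ boxSpan K y e' d := by
    intro x
    have hx : x ∈ Submodule.span (MvPolynomial (Fin s) K) (Set.range e) := he ▸ Submodule.mem_top
    induction hx using Submodule.closure_induction with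
    | zero => exact ⟨0, zero_mem _⟩
    | add x x' _ _ h h' =>
      obtain ⟨d, hd⟩ := h
      obtain ⟨d', hd'⟩ := h'
      exact ⟨max d d', add_mem (boxSpan_mono (le_max_left _ _) hd)
        (boxSpan_mono (le_max_right _ _) hd')⟩
    | smul_mem q x hx =>
      obtain ⟨l, rfl⟩ := hx
      obtain ⟨d, hd⟩ := exists_aeval_mul_mem_boxSpan (y := y) (e := e') q l
      refine ⟨d, ?_⟩
      rw [hy] at hd
      exact hd
  choose d hd using hR
  -- One box size for the unit and all products of a generator with a module generator.
  let D := d 1 + ∑ w ∈ S.attach, ∑ l, d (⟨w, Algebra.subset_adjoin w.2⟩ * e l)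
  refine growthDegree_le (D := D) (t := t) hs fun i => ?_
  refine (Submodule.finrank_mono (standardFiltration_le_boxSpan (y := y) (e := e') (D := D)
    ?_ ?_ i)).trans (finrank_boxSpan_le _)
  · exact boxSpan_mono (Nat.le_add_right _ _) (hd 1)
  · intro w hw l
    refine boxSpan_mono ?_ (hd (⟨w, Algebra.subset_adjoin hw⟩ * e l))
    refine le_add_left ((Finset.single_le_sum (f := fun l => d (⟨w, Algebra.subset_adjoin hw⟩ * e l))
      (fun _ _ => Nat.zero_le _) (Finset.mem_univ l)).trans ?_)
    exact Finset.single_le_sum (f := fun w : {x // x ∈ S} =>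
      ∑ l, d (⟨w, Algebra.subset_adjoin w.2⟩ * e l)) (fun _ _ => Nat.zero_le _)
      (Finset.mem_attach S ⟨w, hw⟩)

end GrowthBound

/-! ### Simplicity and centre from commutators -/

section SimpleCentral

open MvPolynomial

variable {K A σ : Type*} [Field K] [Ring A] [Algebra K A]
  {f : MvPolynomial σ K →ₐ[K] A} {g : MvPolynomial σ K →ₐ[K] A}

/-- Commuting with `x_j` removes one factor `∂_j` at a time. Together with `hu`, this makes
two-sided ideals stable under differentiation in both sets of variables. -/
theorem normalOrder_pderiv (hu : ∀ i b, g (X i) * f b = f b * g (X i) + f (pderiv i b)) (j : σ)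
    (Q : MvPolynomial σ (MvPolynomial σ K)) :
    normalOrder f g (pderiv j Q) = normalOrder f g Q * f (X j) - f (X j) * normalOrder f g Q := by
  classical
  induction Q using MvPolynomial.induction_on with
  | C p =>
    rw [pderiv_C, map_zero, normalOrder_C, ← map_mul, ← map_mul, mul_comm, sub_self]
  | add p q hp hq =>
    rw [map_add, map_add, map_add, hp, hq]
    noncomm_ring
  | mul_X Q i hQ =>
    rw [Derivation.leibniz, smul_eq_mul, smul_eq_mul, map_add, mul_comm (X i), normalOrder_mul_X, hQ,
      normalOrder_mul_X, mul_assoc _ (g (X i)), hu, pderiv_X, pderiv_X, Pi.single_apply,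
      Pi.single_apply]
    rcases eq_or_ne i j with rfl | h
    · simp only [if_true, mul_one, map_one]
      noncomm_ring
    · rw [if_neg h, if_neg h.symm, map_zero, mul_zero, map_zero]
      noncomm_ring

/-- Inside a nonzero ideal, differentiating in the `ξ_j` leads to a nonzero polynomial in the `x_i`,
and differentiating that leads to a nonzero scalar. -/
theorem isSimpleRing_of_normalOrder_surjective [CharZero K] [Nontrivial A]
    (hu : ∀ i b, g (X i) * f b = f b * g (X i) + f (pderiv i b))
    (hs : Function.Surjective (normalOrder f g)) : IsSimpleRing A := by
  refine ⟨⟨fun I => or_iff_not_imp_left.mpr fun hI => ?_⟩⟩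
  obtain ⟨x, hx, hx0⟩ : ∃ x ∈ I, x ≠ 0 := by
    by_contra! h
    exact hI (eq_bot_iff.mpr fun x hx => (TwoSidedIdeal.mem_bot A).mpr (h x hx))
  obtain ⟨Q, rfl⟩ := hs x
  have hQ0 : Q ≠ 0 := fun h => hx0 (by rw [h, map_zero])
  obtain ⟨p, hp0, hp⟩ := exists_C_mem_of_pderiv_mem {Q | normalOrder f g Q ∈ I}
    (fun Q hQ i => by
      rw [Set.mem_ofPred_eq, normalOrder_pderiv hu]
      exact I.sub_mem (I.mul_mem_right _ _ hQ) (I.mul_mem_left _ _ hQ)) hx hQ0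
  rw [Set.mem_ofPred_eq, normalOrder_C] at hp
  obtain ⟨c, hc0, hc⟩ := exists_C_mem_of_pderiv_mem {p | f p ∈ I}
    (fun p hp i => by
      rw [Set.mem_ofPred_eq, show f (pderiv i p) = g (X i) * f p - f p * g (X i) by
        rw [hu, add_sub_cancel_left]]
      exact I.sub_mem (I.mul_mem_left _ _ hp) (I.mul_mem_right _ _ hp)) hp hp0
  refine (TwoSidedIdeal.one_mem_iff I).mp ?_
  have h1 := I.mul_mem_left (f (C c⁻¹)) _ hc
  rwa [← map_mul, ← C_mul, inv_mul_cancel₀ hc0, C_1, map_one] at h1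

/-- For a central element all commutators vanish, so by injectivity its normal form is constant
first in the `ξ_j` and then in the `x_j`. -/
theorem isCentral_of_normalOrder_bijective [CharZero K]
    (hu : ∀ i b, g (X i) * f b = f b * g (X i) + f (pderiv i b))
    (hs : Function.Bijective (normalOrder f g)) : Algebra.IsCentral K A := by
  refine ⟨fun z hz => ?_⟩
  rw [Subalgebra.mem_center_iff] at hz
  obtain ⟨Q, rfl⟩ := hs.2 z
  have hQ : ∀ j, pderiv j Q = 0 := fun j => hs.1 (by
    rw [normalOrder_pderiv hu, hz, sub_self, map_zero])
  rw [eq_C_of_pderiv_eq_zero hQ] at hz ⊢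
  generalize coeff 0 Q = p at hz ⊢
  have hp : ∀ j, pderiv j p = 0 := fun j => C_injective σ _ (hs.1 (by
    have h := hu j p
    rw [normalOrder_C] at hz
    rw [hz, left_eq_add] at h
    rw [normalOrder_C, h, C_0, map_zero]))
  rw [eq_C_of_pderiv_eq_zero hp, normalOrder_C]
  exact Algebra.mem_bot.mpr ⟨_, (f.commutes _).symm⟩

end SimpleCentral

/-! ### Normal forms in the Weyl algebra -/

section WeylNormalForm

open MvPolynomial

variable (K : Type*) [Field K] (m : ℕ)

theorem WeylAlgebra.x_mul_x (i j : Fin m) : x K m i * x K m j = x K m j * x K m i := by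
  rw [x, x, ← map_mul, ← map_mul]
  exact RingQuot.mkAlgHom_rel K (WeylRel.x_comm i j)

theorem WeylAlgebra.d_mul_d (i j : Fin m) : d K m i * d K m j = d K m j * d K m i := by
  rw [d, d, ← map_mul, ← map_mul]
  exact RingQuot.mkAlgHom_rel K (WeylRel.d_comm i j)

theorem WeylAlgebra.d_mul_x (i j : Fin m) :
    d K m i * x K m j = x K m j * d K m i + if i = j then 1 else 0 := by
  have h := RingQuot.mkAlgHom_rel K (WeylRel.d_x (K := K) i j)
  rw [map_sub, map_mul, map_mul, apply_ite (RingQuot.mkAlgHom K (WeylRel K m)), map_one,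
    map_zero] at h
  rw [← h, d, x]
  abel

/-- Algebra homomorphisms from the Weyl algebra. -/
theorem WeylAlgebra.exists_lift {A : Type*} [Ring A] [Algebra K A] (a b : Fin m → A)
    (ha : ∀ i j, a i * a j = a j * a i) (hb : ∀ i j, b i * b j = b j * b i)
    (hba : ∀ i j, b i * a j - a j * b i = if i = j then 1 else 0) :
    ∃ e : WeylAlgebra K m →ₐ[K] A, (∀ i, e (x K m i) = a i) ∧ ∀ i, e (d K m i) = b i := by
  let F : FreeAlgebra K (Fin m ⊕ Fin m) →ₐ[K] A := FreeAlgebra.lift K (Sum.elim a b)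
  have hF : ∀ ⦃p q⦄, WeylRel K m p q → F p = F q := by
    rintro _ _ (⟨i, j⟩ | ⟨i, j⟩ | ⟨i, j⟩)
    · simpa [F] using ha i j
    · simpa [F] using hb i j
    · simpa [F, apply_ite] using hba i j
  refine ⟨RingQuot.liftAlgHom K ⟨F, hF⟩, fun i => ?_, fun i => ?_⟩
  · rw [x, RingQuot.liftAlgHom_mkAlgHom_apply]
    simp [F]
  · rw [d, RingQuot.liftAlgHom_mkAlgHom_apply]
    simp [F]

variable {K m} {f g : MvPolynomial (Fin m) K →ₐ[K] WeylAlgebra K m}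

theorem WeylAlgebra.commutator_relation (hf : ∀ i, f (X i) = x K m i) (hg : ∀ i, g (X i) = d K m i)
    (i : Fin m) (b : MvPolynomial (Fin m) K) :
    g (X i) * f b = f b * g (X i) + f (pderiv i b) := by
  induction b using MvPolynomial.induction_on with
  | C c =>
    rw [pderiv_C, map_zero, add_zero, show (C c : MvPolynomial (Fin m) K) = algebraMap K _ c from rfl,
      AlgHom.commutes]
    exact (Algebra.commutes c _).symm
  | add p q hp hq =>
    rw [map_add, map_add, map_add, mul_add, add_mul, hp, hq]
    abel
  | mul_X p j hp =>
    have h : x K m j * f (pderiv i p) = f (pderiv i p) * x K m j := by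
      rw [← hf, ← map_mul, mul_comm, map_mul]
    rw [map_mul, ← mul_assoc, hp, Derivation.leibniz, smul_eq_mul, smul_eq_mul, map_add, map_mul,
      map_mul, add_mul, mul_assoc, hf, hg, d_mul_x, pderiv_X, Pi.single_apply, mul_add, h,
      mul_assoc (f p)]
    simp only [apply_ite f, map_one, map_zero, eq_comm (a := j)]
    abel

/-- The range contains the unit and is stable under left multiplication by the generators; a `∂_i`
is moved to the right past the coefficient. -/
theorem WeylAlgebra.normalOrder_surjective (hf : ∀ i, f (X i) = x K m i)
    (hg : ∀ i, g (X i) = d K m i) : Function.Surjective (normalOrder f g) := by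
  have hx : ∀ i w, w ∈ LinearMap.range (normalOrder f g) →
      x K m i * w ∈ LinearMap.range (normalOrder f g) := by
    rintro i _ ⟨Q, rfl⟩
    exact ⟨C (X i) * Q, by rw [normalOrder_C_mul, hf]⟩
  have hd : ∀ i w, w ∈ LinearMap.range (normalOrder f g) →
      d K m i * w ∈ LinearMap.range (normalOrder f g) := by
    rintro i _ ⟨Q, rfl⟩
    induction Q using MvPolynomial.induction_on with
    | C p =>
      refine ⟨C p * X i + C (pderiv i p), ?_⟩
      rw [map_add, normalOrder_mul_X, normalOrder_C, normalOrder_C, ← hg, ← commutator_relation hf hg]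
    | add p q hp hq =>
      rw [map_add, mul_add]
      exact add_mem hp hq
    | mul_X Q j hQ =>
      obtain ⟨R, hR⟩ := hQ
      exact ⟨R * X j, by rw [normalOrder_mul_X, normalOrder_mul_X, hR, mul_assoc]⟩
  have key : ∀ (p : FreeAlgebra K (Fin m ⊕ Fin m)), ∀ w ∈ LinearMap.range (normalOrder f g),
      RingQuot.mkAlgHom K (WeylRel K m) p * w ∈ LinearMap.range (normalOrder f g) := by
    intro p
    induction p using FreeAlgebra.induction with
    | grade0 r =>
      intro w hw
      rw [AlgHom.commutes, ← Algebra.smul_def]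
      exact Submodule.smul_mem _ _ hw
    | grade1 i =>
      intro w hw
      rcases i with i | i
      · exact hx i w hw
      · exact hd i w hw
    | mul p q hp hq =>
      intro w hw
      rw [map_mul, mul_assoc]
      exact hp _ (hq _ hw)
    | add p q hp hq =>
      intro w hw
      rw [map_add, add_mul]
      exact add_mem (hp _ hw) (hq _ hw)
  intro w
  obtain ⟨p, rfl⟩ := RingQuot.mkAlgHom_surjective K (WeylRel K m) w
  have h := key p 1 ⟨C 1, by rw [normalOrder_C, map_one]⟩
  rwa [mul_one] at h

end WeylNormalForm

/-! ### Hamiltonian derivations and the algebra of operators -/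

section Operators

open MvPolynomial

variable (K : Type*) [Field K] (n : ℕ)

/-- The Hamiltonian vector field `{a, ·}` as a derivation. -/
noncomputable def hamiltonianDerivation (a : MvPolynomial (Fin (n + n)) K) :
    Derivation K (MvPolynomial (Fin (n + n)) K) (MvPolynomial (Fin (n + n)) K) :=
  Derivation.mk' (classicalBracket K n a) fun x y => by
    rw [classicalBracket_leibniz]
    simp only [smul_eq_mul]
    ring

variable {K n}

/-- Brackets with the coordinates are the partial derivatives up to order and sign, so the Jacobian
criterion applies. -/
theorem linearIndependent_bracket_X [CharZero K] {m : ℕ} {a : Fin m → MvPolynomial (Fin (n + n)) K}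
    (ha : AlgebraicIndependent K a) :
    LinearIndependent (FractionRing (MvPolynomial (Fin (n + n)) K)) fun i k =>
      algebraMap _ (FractionRing (MvPolynomial (Fin (n + n)) K))
        (classicalBracket K n (a i) (X k)) := by
  have h := ha.linearIndependent_pderiv
  rw [Fintype.linearIndependent_iff] at h ⊢
  intro c hc
  refine h c (funext fun k => ?_)
  have hc' := fun k => congrFun hc k
  simp only [Finset.sum_apply, Pi.smul_apply, Pi.zero_apply] at hc' ⊢
  refine Fin.addCases (fun k => ?_) (fun k => ?_) k
  · simpa only [classicalBracket_X_natAdd] using hc' (Fin.natAdd n k)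
  · simpa only [classicalBracket_X_castAdd, map_neg, smul_neg, Finset.sum_neg_distrib,
      neg_eq_zero] using hc' (Fin.castAdd n k)

/-- Poisson commuting algebraically independent polynomials in `2n` variables: there are at most
`n` of them. -/
theorem card_le_of_bracket_eq_zero [CharZero K] {m : ℕ}
    {a : Fin m → MvPolynomial (Fin (n + n)) K} (ha : AlgebraicIndependent K a)
    (h0 : ∀ i j, classicalBracket K n (a i) (a j) = 0) : m ≤ n := by
  let L := FractionRing (MvPolynomial (Fin (n + n)) K)
  let V : Matrix (Fin m) (Fin (n + n)) L := fun i k => algebraMap _ L (pderiv k (a i))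
  let W : Matrix (Fin m) (Fin (n + n)) L := fun i k =>
    algebraMap _ L (classicalBracket K n (a i) (X k))
  have hV : V.rank = m := by
    rw [LinearIndependent.rank_matrix (M := V) ha.linearIndependent_pderiv, Fintype.card_fin]
  have hW : W.rank = m := by
    rw [LinearIndependent.rank_matrix (M := W) (linearIndependent_bracket_X ha), Fintype.card_fin]
  -- The entry at `i`, `j` is the bracket `{a_j, a_i}`.
  have hVW : V * W.transpose = 0 := by
    ext i j
    have h1 : ∑ k, pderiv k (a i) * classicalBracket K n (a j) (X k) = 0 := by
      rw [← h0 j i, Fin.sum_univ_add, classicalBracket_apply, ← Finset.sum_add_distrib]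
      refine Finset.sum_congr rfl fun k _ => ?_
      rw [classicalBracket_X_natAdd, classicalBracket_X_castAdd]
      ring
    have h2 := congrArg (algebraMap _ L) h1
    rw [map_sum, map_zero] at h2
    simp only [map_mul] at h2
    exact h2
  have h := Matrix.rank_add_rank_le_card_of_mul_eq_zero hVW
  rw [Matrix.rank_transpose, hV, hW, Fintype.card_fin] at h
  omega

/-- The commutation rule of derivations and multiplications. -/
theorem derivation_commutation {P ι : Type*} [CommRing P] [Algebra K P] (u : ι → Derivation K P P)
    {g : MvPolynomial ι K →ₐ[K] Module.End K P} (hg : ∀ i, g (X i) = (u i).toLinearMap) (i : ι)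
    (b : P) : g (X i) * Algebra.lmul K P b
      = Algebra.lmul K P b * g (X i) + Algebra.lmul K P (u i b) := by
  rw [hg]
  refine LinearMap.ext fun x => ?_
  change u i (b * x) = b * u i x + u i b * x
  rw [Derivation.leibniz, smul_eq_mul, smul_eq_mul, mul_comm x]

theorem normalOrder_bracket_injective [CharZero K] {m : ℕ}
    {a : Fin m → MvPolynomial (Fin (n + n)) K} (ha : AlgebraicIndependent K a)
    {g : MvPolynomial (Fin m) K →ₐ[K] Module.End K (MvPolynomial (Fin (n + n)) K)}
    (hg : ∀ i, g (X i) = (poissonPolynomial K n).ad (a i)) :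
    Function.Injective (normalOrder (Algebra.lmul K (MvPolynomial (Fin (n + n)) K)) g) := by
  refine normalOrder_injective _ g (fun i => hamiltonianDerivation K n (a i))
    (derivation_commutation _ hg) Algebra.lmul_injective fun p hp => ?_
  have h := linearIndependent_bracket_X ha
  rw [Fintype.linearIndependent_iff] at h
  funext i
  refine FaithfulSMul.algebraMap_injective (MvPolynomial (Fin (n + n)) K)
    (FractionRing (MvPolynomial (Fin (n + n)) K)) ?_
  rw [Pi.zero_apply, map_zero]
  refine h (fun i => algebraMap _ _ (p i)) (funext fun k => ?_) i
  have h1 := congrArg (algebraMap _ (FractionRing (MvPolynomial (Fin (n + n)) K))) (hp (X k))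
  rw [map_sum, map_zero] at h1
  rw [Finset.sum_apply, Pi.zero_apply, ← h1]
  refine Finset.sum_congr rfl fun i _ => ?_
  rw [map_mul, mul_comm]
  rfl

theorem normalOrder_pderiv_injective [CharZero K]
    {g : MvPolynomial (Fin n) K →ₐ[K] Module.End K (MvPolynomial (Fin n) K)}
    (hg : ∀ i, g (X i) = (pderiv i).toLinearMap) :
    Function.Injective (normalOrder (Algebra.lmul K (MvPolynomial (Fin n) K)) g) := by
  classical
  refine normalOrder_injective _ g (fun i => pderiv i) (derivation_commutation _ hg)
    Algebra.lmul_injective fun p hp => funext fun i => ?_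
  have h := hp (X i)
  simpa [pderiv_X, Pi.single_apply] using h

/-- The homomorphism `φ` factors as the substitution `θ` of the `a i` and the `ξ_i`, followed by
normal ordering; both are injective. -/
theorem commAlgIndep_opMul_opAd [CharZero K] {m : ℕ}
    {a : Fin m → MvPolynomial (Fin (n + n)) K} (ha : AlgebraicIndependent K a)
    (h0 : ∀ i j, classicalBracket K n (a i) (a j) = 0) :
    CommAlgIndep K (Sum.elim (fun i => (poissonPolynomial K n).opMul (a i))
      (fun i => (poissonPolynomial K n).opAd (a i))) := by
  set B := poissonPolynomial K n
  have hmm : ∀ i j, B.opMul (a i) * B.opMul (a j) = B.opMul (a j) * B.opMul (a i) := fun i j =>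
    Subtype.ext (LinearMap.ext fun x => mul_left_comm (a i) (a j) x)
  have hma : ∀ i j, B.opMul (a i) * B.opAd (a j) = B.opAd (a j) * B.opMul (a i) := fun i j =>
    Subtype.ext (LinearMap.ext fun x => by
      change a i * classicalBracket K n (a j) x = classicalBracket K n (a j) (a i * x)
      rw [classicalBracket_leibniz, h0, zero_mul, zero_add])
  have haa : ∀ i j, B.opAd (a i) * B.opAd (a j) = B.opAd (a j) * B.opAd (a i) := fun i j =>
    Subtype.ext (LinearMap.ext fun x => by
      change classicalBracket K n (a i) (classicalBracket K n (a j) x)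
        = classicalBracket K n (a j) (classicalBracket K n (a i) x)
      have h := classicalBracket_bracket K n (a i) (a j) x
      rw [h0, map_zero, LinearMap.zero_apply] at h
      exact sub_eq_zero.mp h.symm)
  obtain ⟨φ, hφ⟩ := exists_algHom_of_commute (K := K)
    (Sum.elim (fun i => B.opMul (a i)) (fun i => B.opAd (a i))) (by
      rintro (i | i) (j | j)
      · exact hmm i j
      · exact hma i j
      · exact (hma j i).symm
      · exact haa i j)
  refine ⟨φ, hφ, ?_⟩
  let g : MvPolynomial (Fin m) K →ₐ[K] Module.End K (MvPolynomial (Fin (n + n)) K) :=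
    (B.opAlgebra.val.comp φ).comp (rename Sum.inr)
  have hg : ∀ i, g (X i) = B.ad (a i) := fun i => by
    simp only [g, AlgHom.comp_apply, rename_X, hφ]
    rfl
  let θ : MvPolynomial (Fin m ⊕ Fin m) K →ₐ[K] MvPolynomial (Fin m) (MvPolynomial (Fin (n + n)) K) :=
    aeval (Sum.elim (fun i => C (a i)) X)
  -- The `ξ_i` are independent over `P` and the `a i` over `K`, hence they are jointly independent
  -- over `K`.
  have hθ : Function.Injective θ := by
    have h := ha.sumElim_comp (algebraicIndependent_X (Fin m) (MvPolynomial (Fin (n + n)) K))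
    have h' := h.comp _ (Equiv.sumComm (Fin m) (Fin m)).injective
    have e : Sum.elim X (algebraMap (MvPolynomial (Fin (n + n)) K)
        (MvPolynomial (Fin m) (MvPolynomial (Fin (n + n)) K)) ∘ a) ∘ Equiv.sumComm (Fin m) (Fin m)
        = Sum.elim (fun i => C (a i)) X := by
      funext i
      rcases i with i | i <;> rfl
    rw [e] at h'
    exact h'
  have key : ∀ p, (φ p : Module.End K (MvPolynomial (Fin (n + n)) K))
      = normalOrder (Algebra.lmul K _) g (θ p) := by
    intro p
    induction p using MvPolynomial.induction_on with
    | C c =>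
      have h1 : θ (C c) = C (C c) := θ.commutes c
      have h2 : φ (C c) = algebraMap K _ c := φ.commutes c
      rw [h1, h2, normalOrder_C]
      exact ((Algebra.lmul K (MvPolynomial (Fin (n + n)) K)).commutes c).symm
    | add p q hp hq => rw [map_add, map_add, map_add, ← hp, ← hq]; rfl
    | mul_X p i hp =>
      -- Normal ordering is compatible with `a i` on the left and `ξ_i` on the right; commutativity
      -- of the source lets each factor be put on its proper side.
      rcases i with i | i
      · rw [mul_comm, map_mul, map_mul, show θ (X (Sum.inl i)) = C (a i) by simp [θ],
          normalOrder_C_mul, ← hp, hφ]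
        rfl
      · rw [map_mul, map_mul, show θ (X (Sum.inr i)) = X i by simp [θ], normalOrder_mul_X, ← hp, hφ,
          hg]
        rfl
  intro p q hpq
  exact hθ (normalOrder_bracket_injective ha hg (by rw [← key, ← key, hpq]))

variable (K n)

/-- The partial derivatives belong to `A(P_{2n})`. -/
theorem pderiv_mem_opAlgebra (j : Fin (n + n)) :
    (pderiv j : Derivation K (MvPolynomial (Fin (n + n)) K) _).toLinearMap
      ∈ (poissonPolynomial K n).opAlgebra := by
  refine Fin.addCases (fun k => ?_) (fun k => ?_) j
  · convert! neg_mem ((poissonPolynomial K n).opAd (X (Fin.natAdd n k))).2 using 1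
    refine LinearMap.ext fun x => ?_
    change pderiv (Fin.castAdd n k) x = - classicalBracket K n (X (Fin.natAdd n k)) x
    rw [← classicalBracket_swap, classicalBracket_X_natAdd]
  · convert! ((poissonPolynomial K n).opAd (X (Fin.castAdd n k))).2 using 1
    refine LinearMap.ext fun x => ?_
    change pderiv (Fin.natAdd n k) x = classicalBracket K n (X (Fin.castAdd n k)) x
    rw [classicalBracket_swap, classicalBracket_X_castAdd, neg_neg]

theorem opAlgebra_le_of_mem (S : Subalgebra K (Module.End K (MvPolynomial (Fin (n + n)) K)))
    (hm : ∀ a, Algebra.lmul K (MvPolynomial (Fin (n + n)) K) a ∈ S)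
    (hd : ∀ j, (pderiv j : Derivation K (MvPolynomial (Fin (n + n)) K) _).toLinearMap ∈ S) :
    (poissonPolynomial K n).opAlgebra ≤ S := by
  refine Algebra.adjoin_le ?_
  rintro _ (⟨a, rfl⟩ | ⟨a, rfl⟩)
  · exact hm a
  · have h : (poissonPolynomial K n).ad a = ∑ i : Fin n,
        (Algebra.lmul K _ (pderiv (Fin.castAdd n i) a) * (pderiv (Fin.natAdd n i)).toLinearMap
          - Algebra.lmul K _ (pderiv (Fin.natAdd n i) a)
            * (pderiv (Fin.castAdd n i)).toLinearMap) := by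
      refine LinearMap.ext fun x => ?_
      change classicalBracket K n a x = _
      rw [classicalBracket_apply, LinearMap.sum_apply]
      rfl
    rw [h]
    exact sum_mem fun i _ => sub_mem (mul_mem (hm _) (hd _)) (mul_mem (hm _) (hd _))

end Operators

/-! ### The Weyl algebra as an algebra of differential operators -/

section WeylStructure

open MvPolynomial

/-- The polynomial representation of the Weyl algebra. -/
theorem WeylAlgebra.exists_polynomialRep (K : Type*) [Field K] (m : ℕ) :
    ∃ e : WeylAlgebra K m →ₐ[K] Module.End K (MvPolynomial (Fin m) K),
      (∀ j, e (WeylAlgebra.x K m j) = Algebra.lmul K _ (X j)) ∧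
      ∀ j, e (WeylAlgebra.d K m j) = (pderiv j).toLinearMap := by
  classical
  refine WeylAlgebra.exists_lift K m (fun j => Algebra.lmul K _ (X j))
    (fun j => (pderiv j).toLinearMap)
    (fun i j => LinearMap.ext fun x => mul_left_comm (X i) (X j) x)
    (fun i j => LinearMap.ext fun x => pderiv_pderiv_swap K i j x)
    (fun i j => LinearMap.ext fun x => ?_)
  change pderiv i (X j * x) - X j * pderiv i x = _
  rw [Derivation.leibniz, pderiv_X, Pi.single_apply, smul_eq_mul, smul_eq_mul, add_sub_cancel_left]
  rcases eq_or_ne i j with rfl | h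
  · rw [if_pos rfl, if_pos rfl, mul_one]
    rfl
  · rw [if_neg h, if_neg h.symm, mul_zero]
    rfl

instance WeylAlgebra.instNontrivial (K : Type*) [Field K] (m : ℕ) :
    Nontrivial (WeylAlgebra K m) := by
  obtain ⟨e, -⟩ := WeylAlgebra.exists_polynomialRep K m
  exact e.toRingHom.domain_nontrivial

/-- Injectivity can be checked after applying the polynomial representation, where the derivations
`∂_i` are independent. -/
theorem WeylAlgebra.normalOrder_injective {K : Type*} [Field K] [CharZero K] {m : ℕ}
    {f g : MvPolynomial (Fin m) K →ₐ[K] WeylAlgebra K m} (hf : ∀ i, f (X i) = x K m i)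
    (hg : ∀ i, g (X i) = d K m i) : Function.Injective (normalOrder f g) := by
  obtain ⟨e, hex, hed⟩ := WeylAlgebra.exists_polynomialRep K m
  have hef : e.comp f = Algebra.lmul K _ := MvPolynomial.algHom_ext fun j => by
    rw [AlgHom.comp_apply, hf, hex]
  have heg : ∀ j, (e.comp g) (X j) = (pderiv j).toLinearMap := fun j => by
    rw [AlgHom.comp_apply, hg, hed]
  intro Q R hQR
  have h := congrArg e hQR
  rw [map_normalOrder, map_normalOrder, hef] at h
  exact normalOrder_pderiv_injective heg h

theorem WeylAlgebra.isSimpleRing_and_isCentral (K : Type*) [Field K] [CharZero K] (m : ℕ) :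
    IsSimpleRing (WeylAlgebra K m) ∧ Algebra.IsCentral K (WeylAlgebra K m) := by
  obtain ⟨f, hf⟩ := exists_algHom_of_commute (K := K) _ (WeylAlgebra.x_mul_x K m)
  obtain ⟨g, hg⟩ := exists_algHom_of_commute (K := K) _ (WeylAlgebra.d_mul_d K m)
  have hu := WeylAlgebra.commutator_relation hf hg
  have hs := WeylAlgebra.normalOrder_surjective hf hg
  exact ⟨isSimpleRing_of_normalOrder_surjective hu hs,
    isCentral_of_normalOrder_bijective hu ⟨WeylAlgebra.normalOrder_injective hf hg, hs⟩⟩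

/-- The canonical isomorphism of the Weyl algebra with the algebra of operators. -/
theorem exists_weylAlgebra_equiv (K : Type*) [Field K] [CharZero K] (n : ℕ) :
    ∃ e : WeylAlgebra K (n + n) ≃ₐ[K] (poissonPolynomial K n).opAlgebra,
      (∀ j, e (WeylAlgebra.x K (n + n) j) = (poissonPolynomial K n).opMul (X j)) ∧
      ∀ j, (e (WeylAlgebra.d K (n + n) j) : Module.End K (MvPolynomial (Fin (n + n)) K)) =
          (pderiv j).toLinearMap := by
  set B := poissonPolynomial K n
  obtain ⟨E, hEx, hEd⟩ := WeylAlgebra.exists_polynomialRep K (n + n)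
  obtain ⟨f, hf⟩ := exists_algHom_of_commute (K := K) _ (WeylAlgebra.x_mul_x K (n + n))
  have hEf : E.comp f = Algebra.lmul K _ := MvPolynomial.algHom_ext fun j => by
    rw [AlgHom.comp_apply, hf, hEx]
  -- A ring homomorphism from a simple ring to a nonzero ring is injective.
  have hinj : Function.Injective E := by
    have := (WeylAlgebra.isSimpleRing_and_isCentral K (n + n)).1
    exact E.toRingHom.injective
  have hrange : E.range = B.opAlgebra := by
    refine le_antisymm ?_ (opAlgebra_le_of_mem K n E.range
      (fun a => ⟨f a, congrArg (fun F => F a) hEf⟩) (fun j => ⟨_, hEd j⟩))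
    rintro _ ⟨w, rfl⟩
    obtain ⟨p, rfl⟩ := RingQuot.mkAlgHom_surjective K (WeylRel K (n + n)) w
    change E (RingQuot.mkAlgHom K (WeylRel K (n + n)) p) ∈ B.opAlgebra
    induction p using FreeAlgebra.induction with
    | grade0 r =>
      rw [AlgHom.commutes, AlgHom.commutes]
      exact B.opAlgebra.algebraMap_mem r
    | grade1 i =>
      rcases i with i | i
      · exact (hEx i).symm ▸ (B.opMul (X i)).2
      · exact (hEd i).symm ▸ pderiv_mem_opAlgebra K n i
    | mul p q hp hq => rw [map_mul, map_mul]; exact mul_mem hp hq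
    | add p q hp hq => rw [map_add, map_add]; exact add_mem hp hq
  refine ⟨(AlgEquiv.ofInjective E hinj).trans (Subalgebra.equivOfEq _ _ hrange),
    fun j => Subtype.ext (hEx j), hEd⟩

end WeylStructure

/-! ### Strong simplicity and the isotropic bound -/

theorem poissonPolynomial_isStronglySimple (K : Type*) [Field K] [CharZero K] (n : ℕ) :
    (poissonPolynomial K n).IsStronglySimple := by
  obtain ⟨e, -⟩ := exists_weylAlgebra_equiv K n
  obtain ⟨hs, hc⟩ := WeylAlgebra.isSimpleRing_and_isCentral K (n + n)
  exact
    { finiteType := inferInstance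
      isDomain := inferInstance
      isCentral := Algebra.IsCentral.of_algEquiv K _ _ e
      isSimple := IsSimpleRing.of_ringEquiv e.toRingEquiv hs
      algIndep := fun m a ha h0 => commAlgIndep_opMul_opAd ha h0 }

theorem gkDim_le_of_isIsotropic {K : Type*} [Field K] [CharZero K] {n : ℕ}
    {C : Subalgebra K (MvPolynomial (Fin (n + n)) K)} (hC : (poissonPolynomial K n).IsIsotropic C) :
    gkDim K C ≤ ((n : ℕ) : EReal) :=
  gkDim_le_of_algebraicIndependent fun _ a ha =>
    card_le_of_bracket_eq_zero (ha.map' (f := C.val) Subtype.val_injective)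
      fun i j => hC _ (a i).2 _ (a j).2

theorem corollary4p2 (K : Type*) [Field K] [CharZero K] (n : ℕ) :
    ((poissonPolynomial K n).IsStronglySimple ∧
      ∃ e : WeylAlgebra K (n + n) ≃ₐ[K] (poissonPolynomial K n).opAlgebra,
        (∀ j : Fin (n + n),
          e (WeylAlgebra.x K (n + n) j) = (poissonPolynomial K n).opMul (MvPolynomial.X j)) ∧
        (∀ j : Fin (n + n),
          (e (WeylAlgebra.d K (n + n) j) : Module.End K (MvPolynomial (Fin (n + n)) K)) =
            (MvPolynomial.pderiv j).toLinearMap)) ∧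
    ∀ C : Subalgebra K (MvPolynomial (Fin (n + n)) K),
      (poissonPolynomial K n).IsIsotropic C → gkDim K C ≤ ((n : ℕ) : EReal) :=
  ⟨⟨poissonPolynomial_isStronglySimple K n, exists_weylAlgebra_equiv K n⟩,
    fun _ hC => gkDim_le_of_isIsotropic hC⟩
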